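/- For a finite simple graph $G$ with nonempty vertex set $V$, let $\alpha(G)$ be its independence number. Let $G^{k}$ denote the $k$-th strong power of $G$: its vertices are the words in $V^k$, and distinct words $x,y$ are adjacent iff for every $i$ either $x_i=y_i$ or $x_i$ is adjacent to $y_i$ in $G$. The Shannon zero-error capacity of $G$ is $\Theta(G)=\sup_{k\ge 1}\alpha(G^{k})^{1/k}$. An orthonormal representation of $G$ is a family $(u_i)_{i\in V}$ of unit vectors in some $\mathbb{R}^m$ such that $u_i\perp u_j$ whenever $i\neq j$ are nonadjacent. The Lovász bound is $$v(G)=\inf_{c,\,(u_i)}\ \max_{i\in V}\ \frac{1}{\langle c,u_i\rangle^2},$$ where the infimum runs over all orthonormal representations $(u_i)$ of $G$ and all unit vectors $c$ in the same space (with $1/0=+\infty$). For integers $q\ge 1$ and $1\le d\le n$, the Hamming graph $H_q(n,d)$ has vertex set $\{0,\dots,q-1\}^n$, and two words are adjacent iff their Hamming distance is at least $d$. A $q$-ary code of length $n$ and minimum distance at least $d$ is a set $C\subseteq\{0,\dots,q-1\}^n$ whose distinct elements have pairwise Hamming distance at least $d$. For the given $d$, it is perfect if it attains the Hamming bound, $|C|\sum_{i=0}^{\lfloor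 (d-1)/2\rfloor}\binom{n}{i}(q-1)^i=q^n$, and MDS if it attains the Singleton bound, $|C|=q^{n-d+1}$. **Lemma.** Let $q\ge 1$ and $n\ge 1$. Then $v(G)=\Theta(G)$ for each of the following graphs $G$: 1. $G=H_q(n,d)$ with $1\le d\le n$, when there exists a $q$-ary perfect code of length $n$ and minimum distance at least $d$; 2. $G=H_q(n,d)$ with $1\le d\le n$, when $q\ge n-d+2$ and there exists a $q$-ary MDS code of length $n$ and minimum distance at least $d$; 3. $G=H_q(n,n)$. -/

import Mathlib

noncomputable section

namespace ZeroError

/-- The `k`-th strong power of `G`: distinct words of length `k` over the vertices are adjacent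
(confusable) iff in every position their letters are equal or adjacent in `G`. -/
def strongPower {V : Type*} (G : SimpleGraph V) (k : ℕ) : SimpleGraph (Fin k → V) where
  Adj x y := x ≠ y ∧ ∀ i, x i = y i ∨ G.Adj (x i) (y i)
  symm := ⟨fun _ _ h => ⟨h.1.symm, fun i => (h.2 i).imp Eq.symm fun e => e.symm⟩⟩
  loopless := ⟨fun _ h => h.1 rfl⟩

/-- The Shannon zero-error capacity `Θ(G) = sup_{k ≥ 1} α(G^k)^{1/k}`. -/
def shannonCapacity {V : Type*} (G : SimpleGraph V) : ℝ :=
  ⨆ k : ℕ+, ((strongPower G k).indepNum : ℝ) ^ (1 / ((k : ℕ) : ℝ))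

/-- An orthonormal representation of `G` in `ℝ^m`: a unit vector for each vertex, such that
distinct nonadjacent vertices receive orthogonal vectors. -/
def IsOrthonormalRep {V : Type*} (G : SimpleGraph V) {m : ℕ}
    (u : V → EuclideanSpace ℝ (Fin m)) : Prop :=
  (∀ i, ‖u i‖ = 1) ∧ ∀ i j, i ≠ j → ¬ G.Adj i j → inner ℝ (u i) (u j) = 0

/-- The Lovász bound: the infimum, over all orthonormal representations `u` of `G` and all unit
vectors `c`, of `max_i 1 / ⟨c, u i⟩ ^ 2`. Pairs with some `⟨c, u i⟩ = 0` have value `+∞`,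
so they are left out. -/
def lovaszTheta {V : Type*} (G : SimpleGraph V) : ℝ :=
  sInf {t : ℝ | ∃ (m : ℕ) (u : V → EuclideanSpace ℝ (Fin m)) (c : EuclideanSpace ℝ (Fin m)),
    IsOrthonormalRep G u ∧ ‖c‖ = 1 ∧ (∀ i, inner ℝ c (u i) ≠ 0) ∧
      t = ⨆ i, 1 / (inner ℝ c (u i)) ^ 2}

/-- The Hamming graph `H_q(n,d)`: words of length `n` over an alphabet of `q` letters,
adjacent iff their Hamming distance is at least `d` (for `d ≥ 1` the condition `x ≠ y`
is automatic). -/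
def hammingGraph (q n d : ℕ) : SimpleGraph (Fin n → Fin q) where
  Adj x y := x ≠ y ∧ d ≤ hammingDist x y
  symm := ⟨fun x y h => ⟨h.1.symm, (hammingDist_comm x y) ▸ h.2⟩⟩
  loopless := ⟨fun _ h => h.1 rfl⟩

/-- `C` is a `q`-ary code of length `n` and minimum distance at least `d`. -/
def IsCode {q n : ℕ} (d : ℕ) (C : Finset (Fin n → Fin q)) : Prop :=
  ∀ x ∈ C, ∀ y ∈ C, x ≠ y → d ≤ hammingDist x y

/-- A perfect code: a code of minimum distance at least `d` that attains the Hamming bound. -/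
def IsPerfectCode {q n : ℕ} (d : ℕ) (C : Finset (Fin n → Fin q)) : Prop :=
  IsCode d C ∧
    C.card * ∑ i ∈ Finset.range ((d - 1) / 2 + 1), n.choose i * (q - 1) ^ i = q ^ n

/-- An MDS code: a code of minimum distance at least `d` that attains the Singleton bound. -/
def IsMDSCode {q n : ℕ} (d : ℕ) (C : Finset (Fin n → Fin q)) : Prop :=
  IsCode d C ∧ C.card = q ^ (n - d + 1)

end ZeroError

end

noncomputable section

namespace ZeroError

open Finset

/-! Always α(G) ≤ Θ(G) ≤ v(G); the second bound is Bessel's inequality for tensor powers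
(`indepNum_strongPower_le`). If N cliques cover every vertex exactly r times, their incidence
vectors give v(G) ≤ N/r, so an independent set of size N/r makes all three numbers equal
(`lovaszTheta_eq_shannonCapacity_of_cliqueCover`). In a Hamming graph, codes are cliques and sets of
diameter below d are independent. The q^n translates of a code C cover each word |C| times, so such
a set A with |A||C| = q^n suffices: a ball for a perfect code, a subcube for an MDS code. For d = n
the repetition code is MDS. -/

/-- The `k`-fold tensor product of the vectors `v 0, …, v (k - 1)` of `ℝ^m`. -/
def tensorVec {k m : ℕ} (v : Fin k → EuclideanSpace ℝ (Fin m)) :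
    EuclideanSpace ℝ (Fin k → Fin m) :=
  WithLp.toLp 2 fun f => ∏ i, v i (f i)

theorem inner_tensorVec {k m : ℕ} (v w : Fin k → EuclideanSpace ℝ (Fin m)) :
    inner ℝ (tensorVec v) (tensorVec w) = ∏ i, inner ℝ (v i) (w i) := by
  simp only [tensorVec, PiLp.inner_apply, RCLike.inner_apply, conj_trivial,
    Finset.prod_univ_sum, Fintype.piFinset_univ, Finset.prod_mul_distrib]

theorem norm_tensorVec_eq_one {k m : ℕ} {v : Fin k → EuclideanSpace ℝ (Fin m)}
    (hv : ∀ i, ‖v i‖ = 1) : ‖tensorVec v‖ = 1 := by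
  have h : ‖tensorVec v‖ ^ 2 = 1 := by
    rw [← real_inner_self_eq_norm_sq, inner_tensorVec]
    simp [hv]
  exact (pow_eq_one_iff_of_nonneg (norm_nonneg _) two_ne_zero).1 h

/-- Lovász's bound: an orthonormal representation with handle `c` bounds the independence
numbers of all strong powers. -/
theorem indepNum_strongPower_le {V : Type*} [Nonempty V] {G : SimpleGraph V} {m : ℕ}
    {u : V → EuclideanSpace ℝ (Fin m)} {c : EuclideanSpace ℝ (Fin m)}
    (hu : IsOrthonormalRep G u) (hc : ‖c‖ = 1) (hcu : ∀ i, inner ℝ c (u i) ≠ 0)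
    {t : ℝ} (ht : ∀ i, 1 / (inner ℝ c (u i)) ^ 2 ≤ t) (k : ℕ) :
    ((strongPower G k).indepNum : ℝ) ≤ t ^ k := by
  obtain ⟨s, hs⟩ := (strongPower G k).exists_isNIndepSet_indepNum
  rw [← hs.card_eq]
  set U : (Fin k → V) → EuclideanSpace ℝ (Fin k → Fin m) :=
    fun x => tensorVec fun i => u (x i)
  have horth : Orthonormal ℝ fun x : s => U x := by
    refine ⟨fun x => norm_tensorVec_eq_one fun i => hu.1 _, fun x y hxy => ?_⟩
    have hne : (x : Fin k → V) ≠ y := fun h => hxy (Subtype.ext h)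
    have hnadj : ¬ (strongPower G k).Adj x y := hs.isIndepSet x.2 y.2 hne
    simp only [strongPower, not_and, not_forall, not_or] at hnadj
    -- One coordinate with distinct nonadjacent letters makes a factor of the inner product vanish.
    obtain ⟨i, hi, hi'⟩ := hnadj hne
    simp only [U]
    rw [inner_tensorVec]
    exact Finset.prod_eq_zero (mem_univ i) (hu.2 _ _ hi hi')
  have hbessel := horth.sum_inner_products_le (tensorVec fun _ : Fin k => c) (s := univ)
  rw [norm_tensorVec_eq_one fun _ => hc, one_pow] at hbessel
  have ht0 : 0 ≤ t := le_trans (by positivity) (ht (Classical.arbitrary V))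
  have hterm : ∀ x : s, 1 ≤ t ^ k * ‖inner ℝ (U x) (tensorVec fun _ : Fin k => c)‖ ^ 2 := by
    intro x
    simp only [U]
    rw [real_inner_comm, inner_tensorVec, Real.norm_eq_abs, sq_abs, ← Finset.prod_pow]
    have hpow : t ^ k = ∏ _i : Fin k, t := by simp
    rw [hpow, ← Finset.prod_mul_distrib]
    rw [← Finset.prod_const_one (s := (univ : Finset (Fin k)))]
    refine Finset.prod_le_prod (fun _ _ => zero_le_one) fun i _ => ?_
    have hpos : 0 < inner ℝ c (u (x.1 i)) ^ 2 := by
      have := hcu (x.1 i)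
      positivity
    exact (div_le_iff₀ hpos).1 (ht (x.1 i))
  calc (#s : ℝ) = ∑ _x : s, (1 : ℝ) := by simp
    _ ≤ ∑ x : s, t ^ k * ‖inner ℝ (U x) (tensorVec fun _ : Fin k => c)‖ ^ 2 :=
      Finset.sum_le_sum fun x _ => hterm x
    _ = t ^ k * ∑ x : s, ‖inner ℝ (U x) (tensorVec fun _ : Fin k => c)‖ ^ 2 := by
      rw [Finset.mul_sum]
    _ ≤ t ^ k * 1 := mul_le_mul_of_nonneg_left hbessel (pow_nonneg ht0 k)
    _ = t ^ k := mul_one _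

theorem indepNum_strongPower_rpow_le {V : Type*} [Nonempty V] {G : SimpleGraph V} {m : ℕ}
    {u : V → EuclideanSpace ℝ (Fin m)} {c : EuclideanSpace ℝ (Fin m)}
    (hu : IsOrthonormalRep G u) (hc : ‖c‖ = 1) (hcu : ∀ i, inner ℝ c (u i) ≠ 0)
    {t : ℝ} (ht : ∀ i, 1 / (inner ℝ c (u i)) ^ 2 ≤ t) (k : ℕ+) :
    ((strongPower G k).indepNum : ℝ) ^ (1 / ((k : ℕ) : ℝ)) ≤ t := by
  have ht0 : 0 ≤ t := le_trans (by positivity) (ht (Classical.arbitrary V))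
  calc ((strongPower G k).indepNum : ℝ) ^ (1 / ((k : ℕ) : ℝ))
      ≤ (t ^ (k : ℕ)) ^ (1 / ((k : ℕ) : ℝ)) :=
        Real.rpow_le_rpow (Nat.cast_nonneg _) (indepNum_strongPower_le hu hc hcu ht k)
          (by positivity)
    _ = t := by rw [one_div, Real.pow_rpow_inv_natCast ht0 k.ne_zero]

theorem card_le_indepNum_strongPower_one {V : Type*} [Finite V] {G : SimpleGraph V}
    {A : Finset V} (hA : G.IsIndepSet A) : #A ≤ (strongPower G 1).indepNum := by
  let e : V ↪ (Fin 1 → V) := ⟨fun v _ => v, fun _ _ h => congrFun h 0⟩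
  rw [← Finset.card_map e]
  refine SimpleGraph.IsIndepSet.card_le_indepNum ?_
  intro x hx y hy hxy
  obtain ⟨a, ha, rfl⟩ := Finset.mem_map.1 hx
  obtain ⟨b, hb, rfl⟩ := Finset.mem_map.1 hy
  have hab : a ≠ b := fun h => hxy (by rw [h])
  exact fun h => (h.2 0).elim hab (hA ha hb hab)

/-- A family of `m` cliques covering every vertex exactly `r` times yields an orthonormal
representation together with a unit vector whose squared inner products are all `r / m`. -/
theorem exists_orthonormalRep_of_cliqueCover {V : Type*} {G : SimpleGraph V}
    {m r : ℕ} (hm : 0 < m) (hr : 0 < r) (K : Fin m → Finset V)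
    (hK : ∀ g, G.IsClique (K g)) [DecidableEq V]
    (hcov : ∀ v, #{g | v ∈ K g} = r) :
    ∃ (u : V → EuclideanSpace ℝ (Fin m)) (c : EuclideanSpace ℝ (Fin m)),
      IsOrthonormalRep G u ∧ ‖c‖ = 1 ∧ ∀ i, (inner ℝ c (u i)) ^ 2 = (r : ℝ) / m := by
  have hm' : (0 : ℝ) < m := by exact_mod_cast hm
  have hr' : (0 : ℝ) < r := by exact_mod_cast hr
  -- Incidence vectors of vertices against cliques, normalised. Nonadjacent vertices share no
  -- clique, so their supports are disjoint.
  refine ⟨fun v => WithLp.toLp 2 fun g => if v ∈ K g then (√r)⁻¹ else 0,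
    WithLp.toLp 2 fun _ => (√m)⁻¹, ⟨fun v => ?_, fun v w hvw hadj => ?_⟩, ?_, fun v => ?_⟩
  · rw [EuclideanSpace.norm_eq, Real.sqrt_eq_one]
    simp only [Real.norm_eq_abs, sq_abs, ite_pow, ne_eq, OfNat.ofNat_ne_zero,
      not_false_eq_true, zero_pow, inv_pow, Real.sq_sqrt hr'.le]
    rw [← Finset.sum_filter, Finset.sum_const, hcov v, nsmul_eq_mul, mul_inv_cancel₀ hr'.ne']
  · simp only [PiLp.inner_apply, RCLike.inner_apply, conj_trivial]
    refine Finset.sum_eq_zero fun g _ => ?_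
    by_cases hv : v ∈ K g
    · have hw : w ∉ K g := fun hw => hadj (hK g hv hw hvw)
      simp [hw]
    · simp [hv]
  · rw [EuclideanSpace.norm_eq, Real.sqrt_eq_one]
    simp [Real.sq_sqrt hm'.le, hm'.ne']
  · simp only [PiLp.inner_apply, RCLike.inner_apply, conj_trivial, ite_mul, zero_mul]
    rw [← Finset.sum_filter, Finset.sum_const, hcov v, nsmul_eq_mul, mul_pow, mul_pow, inv_pow,
      inv_pow, Real.sq_sqrt hr'.le, Real.sq_sqrt hm'.le]
    field_simp

/-- If cliques cover every vertex equally often and an independent set attains the resulting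
fractional clique cover bound, then the Lovász bound is the Shannon capacity. -/
theorem lovaszTheta_eq_shannonCapacity_of_cliqueCover {V ι : Type*} [Finite V] [Nonempty V]
    [DecidableEq V] [Fintype ι] {G : SimpleGraph V} {r : ℕ} (hr : 0 < r) (K : ι → Finset V)
    (hK : ∀ g, G.IsClique (K g)) (hcov : ∀ v, #{g | v ∈ K g} = r)
    {A : Finset V} (hA : G.IsIndepSet A) (hcard : #A * r = Fintype.card ι) :
    lovaszTheta G = shannonCapacity G := by
  have hι : 0 < Fintype.card ι := by
    have v := Classical.arbitrary V
    have h : #{g | v ∈ K g} ≤ Fintype.card ι := Finset.card_le_univ _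
    rw [hcov v] at h
    exact hr.trans_le h
  have hr' : (r : ℝ) ≠ 0 := by exact_mod_cast hr.ne'
  have hι' : (Fintype.card ι : ℝ) ≠ 0 := by exact_mod_cast hι.ne'
  let e := Fintype.equivFin ι
  obtain ⟨u, c, hu, hc, huc⟩ := exists_orthonormalRep_of_cliqueCover hι hr
    (fun g => K (e.symm g)) (fun g => hK _) fun v => by
      rw [← hcov v]
      exact Finset.card_equiv e.symm (by simp)
  have hcu : ∀ i, inner ℝ c (u i) ≠ 0 := fun i h => by
    have := huc i
    rw [h, zero_pow two_ne_zero] at this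
    exact div_ne_zero hr' hι' this.symm
  have hval : ∀ i, 1 / (inner ℝ c (u i)) ^ 2 = (#A : ℝ) := fun i => by
    rw [huc i, one_div_div, ← hcard, Nat.cast_mul, mul_div_cancel_right₀ _ hr']
  have hmem : (#A : ℝ) ∈ {t : ℝ | ∃ (m : ℕ) (u : V → EuclideanSpace ℝ (Fin m))
      (c : EuclideanSpace ℝ (Fin m)), IsOrthonormalRep G u ∧ ‖c‖ = 1 ∧
        (∀ i, inner ℝ c (u i) ≠ 0) ∧ t = ⨆ i, 1 / (inner ℝ c (u i)) ^ 2} := by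
    refine ⟨_, u, c, hu, hc, hcu, ?_⟩
    simp only [hval, ciSup_const]
  have hlow : ∀ t ∈ {t : ℝ | ∃ (m : ℕ) (u : V → EuclideanSpace ℝ (Fin m))
      (c : EuclideanSpace ℝ (Fin m)), IsOrthonormalRep G u ∧ ‖c‖ = 1 ∧
        (∀ i, inner ℝ c (u i) ≠ 0) ∧ t = ⨆ i, 1 / (inner ℝ c (u i)) ^ 2}, (#A : ℝ) ≤ t := by
    rintro t ⟨m, u, c, hu, hc, hcu, rfl⟩
    have h := indepNum_strongPower_le hu hc hcu
      (fun i => le_ciSup (f := fun i => 1 / (inner ℝ c (u i)) ^ 2) (Set.finite_range _).bddAbove i) 1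
    rw [pow_one] at h
    exact le_trans (by exact_mod_cast card_le_indepNum_strongPower_one hA) h
  have hθ : lovaszTheta G = #A :=
    le_antisymm (csInf_le ⟨_, hlow⟩ hmem) (le_csInf ⟨_, hmem⟩ hlow)
  have hup : ∀ k : ℕ+, ((strongPower G k).indepNum : ℝ) ^ (1 / ((k : ℕ) : ℝ)) ≤ #A :=
    indepNum_strongPower_rpow_le hu hc hcu fun i => (hval i).le
  rw [hθ]
  refine le_antisymm ?_ (ciSup_le hup)
  -- The term k = 1 of the supremum already reaches |A|.
  refine le_trans ?_ (le_ciSup ⟨(#A : ℝ), Set.forall_mem_range.2 hup⟩ 1)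
  simpa using card_le_indepNum_strongPower_one hA

/-! ### Codes and anticodes in Hamming graphs -/

theorem hammingDist_add_right {n q : ℕ} [NeZero q] (x y g : Fin n → Fin q) :
    hammingDist (x + g) (y + g) = hammingDist x y :=
  hammingDist_comp (fun i a => a + g i) fun i => add_left_injective (g i)

/-- A code and an anticode whose sizes multiply to `q ^ n` determine the capacity of the Hamming
graph: the translates of the code form a uniform clique cover. -/
theorem lovaszTheta_hammingGraph_eq {q n d : ℕ} (hq : 1 ≤ q) {C A : Finset (Fin n → Fin q)}
    (hC : IsCode d C) (hA : ∀ x ∈ A, ∀ y ∈ A, hammingDist x y < d)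
    (hcard : #A * #C = q ^ n) :
    lovaszTheta (hammingGraph q n d) = shannonCapacity (hammingGraph q n d) := by
  have : NeZero q := ⟨by omega⟩
  have hCpos : 0 < #C := by
    rcases Nat.eq_zero_or_pos #C with h | h
    · rw [h, mul_zero] at hcard
      exact absurd hcard.symm (pow_pos hq n).ne'
    · exact h
  refine lovaszTheta_eq_shannonCapacity_of_cliqueCover (ι := Fin n → Fin q) hCpos
    (fun g => C.map (addRightEmbedding g)) (fun g x hx y hy hxy => ?_) (fun v => ?_)
    (A := A) (fun x hx y hy _ h => (hA x hx y hy).not_ge h.2) (by simpa using hcard)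
  · obtain ⟨a, ha, rfl⟩ := Finset.mem_map.1 hx
    obtain ⟨b, hb, rfl⟩ := Finset.mem_map.1 hy
    refine ⟨hxy, ?_⟩
    simp only [addRightEmbedding_apply, hammingDist_add_right]
    exact hC a ha b hb fun h => hxy (by rw [h])
  · refine Finset.card_equiv (Equiv.subLeft v) fun g => ?_
    simp only [mem_filter, mem_univ, true_and, Finset.mem_map, addRightEmbedding_apply,
      Equiv.subLeft_apply]
    constructor
    · rintro ⟨a, ha, rfl⟩
      simpa using ha
    · exact fun h => ⟨v - g, h, by simp⟩

theorem card_filter_support_eq {q n : ℕ} [NeZero q] (s : Finset (Fin n)) :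
    #{x : Fin n → Fin q | ({i | x i ≠ 0} : Finset (Fin n)) = s} = (q - 1) ^ #s := by
  have h : ({x : Fin n → Fin q | ({i | x i ≠ 0} : Finset (Fin n)) = s} : Finset _) =
      Fintype.piFinset fun i => if i ∈ s then {0}ᶜ else {0} := by
    ext x
    simp only [mem_filter, mem_univ, true_and, Fintype.mem_piFinset, Finset.ext_iff]
    refine forall_congr' fun i => ?_
    by_cases hi : i ∈ s <;> simp [hi]
  rw [h, Fintype.card_piFinset]
  simp [apply_ite Finset.card, Finset.card_compl]

/-- Words are grouped by their support, an i-element set of positions. -/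
theorem card_filter_hammingNorm_eq {q n : ℕ} [NeZero q] (i : ℕ) :
    #{x : Fin n → Fin q | hammingNorm x = i} = n.choose i * (q - 1) ^ i := by
  rw [Finset.card_eq_sum_card_fiberwise
    (f := fun x : Fin n → Fin q => ({j | x j ≠ 0} : Finset (Fin n)))
    (t := powersetCard i univ)
    (fun x hx => by simpa [hammingNorm, Finset.mem_powersetCard] using hx)]
  rw [Finset.sum_congr rfl (g := fun _ => (q - 1) ^ i) fun s hs => ?_]
  · simp
  · rw [Finset.mem_powersetCard] at hs
    rw [← hs.2, ← card_filter_support_eq s, Finset.filter_filter]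
    congr 1
    ext x
    simp only [mem_filter, mem_univ, true_and, and_iff_right_iff_imp]
    rintro rfl
    rfl

/-- The size of a Hamming ball. -/
theorem card_filter_hammingNorm_lt {q n : ℕ} [NeZero q] (r : ℕ) :
    #{x : Fin n → Fin q | hammingNorm x < r} =
      ∑ i ∈ range r, n.choose i * (q - 1) ^ i := by
  rw [Finset.card_eq_sum_card_fiberwise (f := hammingNorm) (t := range r)
    (fun x hx => by simpa using hx)]
  refine Finset.sum_congr rfl fun i hi => ?_
  rw [← card_filter_hammingNorm_eq, Finset.filter_filter]
  congr 1
  ext x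
  simp only [mem_filter, mem_univ, true_and, and_iff_right_iff_imp]
  rintro rfl
  exact Finset.mem_range.1 hi

theorem lovaszTheta_hammingGraph_eq_of_isPerfectCode {q n d : ℕ} (hq : 1 ≤ q) (hd : 1 ≤ d)
    {C : Finset (Fin n → Fin q)} (hC : IsPerfectCode d C) :
    lovaszTheta (hammingGraph q n d) = shannonCapacity (hammingGraph q n d) := by
  have : NeZero q := ⟨by omega⟩
  refine lovaszTheta_hammingGraph_eq hq hC.1
    (A := {x | hammingNorm x < (d - 1) / 2 + 1}) (fun x hx y hy => ?_) ?_
  · simp only [mem_filter, mem_univ, true_and] at hx hy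
    -- Two words of the ball are at distance at most 2⌊(d-1)/2⌋ < d.
    have h := hammingDist_triangle_right x y 0
    rw [hammingDist_zero_right, hammingDist_zero_right] at h
    omega
  · rw [card_filter_hammingNorm_lt, mul_comm, hC.2]

theorem lovaszTheta_hammingGraph_eq_of_isMDSCode {q n d : ℕ} (hq : 1 ≤ q) (hd : 1 ≤ d)
    (hdn : d ≤ n) {C : Finset (Fin n → Fin q)} (hC : IsMDSCode d C) :
    lovaszTheta (hammingGraph q n d) = shannonCapacity (hammingGraph q n d) := by
  have : NeZero q := ⟨by omega⟩
  -- The anticode is free on d - 1 positions and zero elsewhere; its size q^(d-1) complements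
  -- q^(n-d+1).
  obtain ⟨S, -, hS⟩ := Finset.exists_subset_card_eq (s := (univ : Finset (Fin n))) (n := d - 1)
    (by rw [Finset.card_univ, Fintype.card_fin]; omega)
  refine lovaszTheta_hammingGraph_eq hq hC.1
    (A := Fintype.piFinset fun i => if i ∈ S then univ else {0}) (fun x hx y hy => ?_) ?_
  · rw [Fintype.mem_piFinset] at hx hy
    have hsub : ({i | x i ≠ y i} : Finset (Fin n)) ⊆ S := by
      intro i hi
      by_contra hiS
      have hxi := hx i
      have hyi := hy i
      simp only [hiS, if_false, mem_singleton] at hxi hyi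
      simp [hxi, hyi] at hi
    have h : hammingDist x y ≤ #S := Finset.card_le_card hsub
    omega
  · have hA : #(Fintype.piFinset fun i : Fin n => if i ∈ S then (univ : Finset (Fin q)) else {0})
        = q ^ (d - 1) := by
      rw [Fintype.card_piFinset, ← hS]
      simp [apply_ite Finset.card]
    rw [hA, hC.2, ← pow_add]
    congr 1
    omega

/-- The repetition code is MDS. -/
theorem isMDSCode_repetition {q n : ℕ} (hn : 1 ≤ n) :
    IsMDSCode n (univ.map ⟨fun (a : Fin q) (_ : Fin n) => a,
      fun _ _ h => congrFun h ⟨0, hn⟩⟩) := by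
  refine ⟨fun x hx y hy hxy => ?_, by simp⟩
  obtain ⟨a, -, rfl⟩ := Finset.mem_map.1 hx
  obtain ⟨b, -, rfl⟩ := Finset.mem_map.1 hy
  have hab : a ≠ b := fun h => hxy (by rw [h])
  change n ≤ #{_i : Fin n | a ≠ b}
  simp [hab]

end ZeroError

end

theorem mainTheorem12 (q n : ℕ) (hq : 1 ≤ q) (hn : 1 ≤ n) :
    (∀ d : ℕ, 1 ≤ d → d ≤ n →
      (∃ C : Finset (Fin n → Fin q), ZeroError.IsPerfectCode d C) →
      ZeroError.lovaszTheta (ZeroError.hammingGraph q n d) =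
        ZeroError.shannonCapacity (ZeroError.hammingGraph q n d)) ∧
    (∀ d : ℕ, 1 ≤ d → d ≤ n → n - d + 2 ≤ q →
      (∃ C : Finset (Fin n → Fin q), ZeroError.IsMDSCode d C) →
      ZeroError.lovaszTheta (ZeroError.hammingGraph q n d) =
        ZeroError.shannonCapacity (ZeroError.hammingGraph q n d)) ∧
    ZeroError.lovaszTheta (ZeroError.hammingGraph q n n) =
      ZeroError.shannonCapacity (ZeroError.hammingGraph q n n) := by
  refine ⟨fun d hd _ ⟨C, hC⟩ => ?_, fun d hd hdn _ ⟨C, hC⟩ => ?_, ?_⟩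
  · exact ZeroError.lovaszTheta_hammingGraph_eq_of_isPerfectCode hq hd hC
  · exact ZeroError.lovaszTheta_hammingGraph_eq_of_isMDSCode hq hd hdn hC
  · exact ZeroError.lovaszTheta_hammingGraph_eq_of_isMDSCode hq hn le_rfl
      (ZeroError.isMDSCode_repetition hn)
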